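/- Let $(\mathbb K,|\cdot|)$ be an algebraically closed normed field (the norm being multiplicative), let $f\in\mathbb K[z]$ be a polynomial of degree $n\ge 2$ with leading coefficient $a_0$, let $N\ge 1$ be an integer, let $1\le p\le\infty$ with conjugate exponent $q$ ($1/p+1/q=1$), and put $a=(n-1)^{1/q}$. For $x\in\mathbb K^n$ with distinct components put $$W_i(x)=\frac{f(x_i)}{a_0\prod_{j\ne i}(x_i-x_j)},\qquad d_i(x)=\min_{j\ne i}|x_i-x_j|,\qquad E_f(x)=\left\|\left(\frac{|W_1(x)|}{d_1(x)},\dots,\frac{|W_n(x)|}{d_n(x)}\right)\right\|_p .$$ Define maps $T^{(m)}\colon D_m\subset\mathbb K^n\to\mathbb K^n$ recursively by $D_0=\mathbb K^n$, $T^{(0)}(x)=x$, $$D_{m+1}=\{x\in D_m:\ x_i\ne T^{(m)}_j(x)\ \text{for all } i\ne j\},\qquad T^{(m+1)}_i(x)=x_i-\frac{f(x_i)}{a_0\prod_{j\ne i}\bigl(x_i-T^{(m)}_j(x)\bigr)}\quad(i=1,\dots,n).$$ The $N$-th Weierstrass-type iteration is $x^{(k+1)}=T^{(N)}(x^{(k)})$,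 $k=0,1,2,\dots$; it is well defined if $x^{(k)}\in D_N$ for all $k\ge0$. A vector $\xi\in\mathbb K^n$ is a root-vector of $f$ if $f(z)=c\prod_{i=1}^n(z-\xi_i)$ for all $z\in\mathbb K$, for some $c\in\mathbb K$. Further put $$\mathcal R=\frac{n(2^{1/n}-1)\,\bigl(a+2-n(2^{1/n}-1)\bigr)}{(a+2)\,\bigl(a+2+n(a-1)(2^{1/n}-1)\bigr)},\qquad \alpha(t)=\frac{2}{1-(a-1)t+\sqrt{(1-(a-1)t)^2-4t}} .$$ Suppose $x^{(0)}\in\mathbb K^n$ has distinct components and $$E_f(x^{(0)})\le\frac{n(2^{1/n}-1)(a+1)}{(a+2)(2a+1)} .$$ Then $f$ has only simple zeros in $\mathbb K$, the $N$-th Weierstrass-type iteration starting from $x^{(0)}$ is well defined, and it converges to a root-vector $\xi$ of $f$ with order of convergence (at least) $N+1$, that is, $x^{(k)}\to\xi$ and there is a constant $C$ with $\|x^{(k+1)}-\xi\|_p\le C\,\|x^{(k)}-\xi\|_p^{N+1}$ for all $k\ge0$. Moreover, the a posteriori error estimate $$|x^{(k)}_i-\xi_i|\le\alpha\bigl(E_f(x^{(k)})\bigr)\,|W_i(x^{(k)})|\qquad(i=1,\dots,n)$$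 holds for every $k\ge0$ such that $E_f(x^{(k)})\le\mathcal R$. -/

import Mathlib

open scoped ENNReal

noncomputable section

namespace WeierstrassType

/-- The `p`-norm on `𝕜ⁿ`, `1 ≤ p ≤ ∞`. -/
def pNorm {E : Type*} [NormedField E] {n : ℕ} (p : ℝ≥0∞) (v : Fin n → E) : ℝ :=
  ‖(WithLp.toLp p v : PiLp p fun _ : Fin n => E)‖

variable {K : Type*} [NormedField K] {n : ℕ}

/-- `ξ` is a root-vector of `f`: `f(z) = a₀ ∏ (z - ξ_i)` for all `z`. -/
def IsRootVector (f : Polynomial K) (ξ : Fin n → K) : Prop :=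
  ∃ a₀ : K, ∀ z : K, f.eval z = a₀ * ∏ i, (z - ξ i)

/-- All zeros of `f` are simple. -/
def HasOnlySimpleZeros (f : Polynomial K) : Prop :=
  ∀ z : K, f.IsRoot z → f.rootMultiplicity z = 1

/-- The Weierstrass correction `W_i(x) = f(x_i) / (a₀ ∏_{j ≠ i} (x_i - x_j))`, with `a₀` the leading
coefficient of `f` (meaningful for vectors with distinct components). -/
def weierstrassCorrection (f : Polynomial K) (x : Fin n → K) (i : Fin n) : K :=
  f.eval (x i) / (f.leadingCoeff * ∏ j ∈ Finset.univ.erase i, (x i - x j))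

/-- `d_i(x) = min_{j ≠ i} |x_i - x_j|` (a minimum over a nonempty finite set when `n ≥ 2`). -/
def minDist (x : Fin n → K) (i : Fin n) : ℝ :=
  ⨅ j : {j : Fin n // j ≠ i}, ‖x i - x j‖

/-- `E_f(x) = ‖W_f(x) / d(x)‖_p`. -/
def initialFun (p : ℝ≥0∞) (f : Polynomial K) (x : Fin n → K) : ℝ :=
  pNorm p fun i => ‖weierstrassCorrection f x i‖ / minDist x i

/-- The relation `x # y`: `x_i ≠ y_j` whenever `i ≠ j`. -/
def Sharp (x y : Fin n → K) : Prop := ∀ i j, i ≠ j → x i ≠ y j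

/-- The iteration functions `T^(N)`: `T^(0)(x) = x` and
`T_i^(N+1)(x) = x_i - f(x_i) / (a₀ ∏_{j ≠ i} (x_i - T_j^(N)(x)))`, with `a₀` the leading coefficient
of `f`. They are meaningful on `iterDomain f N`. -/
def iterFun (f : Polynomial K) : ℕ → (Fin n → K) → Fin n → K
  | 0, x => x
  | N + 1, x => fun i =>
      x i - f.eval (x i) /
        (f.leadingCoeff * ∏ j ∈ Finset.univ.erase i, (x i - iterFun f N x j))

/-- The domains `D_N` of `T^(N)`: `D_0 = Kⁿ` and `D_(N+1) = {x ∈ D_N : x # T^(N)(x)}`. -/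
def iterDomain (f : Polynomial K) : ℕ → Set (Fin n → K)
  | 0 => Set.univ
  | N + 1 => {x | x ∈ iterDomain f N ∧ Sharp x (iterFun f N x)}

/-- The iterates `x^(k)` of the `N`-th Weierstrass-type method started at `x₀`. -/
def iter (f : Polynomial K) (N : ℕ) (x₀ : Fin n → K) (k : ℕ) : Fin n → K :=
  (iterFun f N)^[k] x₀

/-- The iteration started at `x₀` is well defined: every iterate lies in the domain of `T^(N)`. -/
def IterWellDefined (f : Polynomial K) (N : ℕ) (x₀ : Fin n → K) : Prop :=
  ∀ k, iter f N x₀ k ∈ iterDomain f N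

/-- The sequence `x` converges to `ξ` with (Q-)order of convergence (at least) `r`. -/
def ConvergesWithOrder (p : ℝ≥0∞) (r : ℕ) (x : ℕ → Fin n → K) (ξ : Fin n → K) : Prop :=
  Filter.Tendsto x Filter.atTop (nhds ξ) ∧
    ∃ C : ℝ, ∀ k, pNorm p (x (k + 1) - ξ) ≤ C * pNorm p (x k - ξ) ^ r

/-- `n (2^{1/n} - 1)`. -/
def tau (n : ℕ) : ℝ := n * ((2 : ℝ) ^ (1 / (n : ℝ)) - 1)

/-- `a = (n - 1)^{1/q}`, with `1/∞ = 0`. -/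
def aConst (n : ℕ) (q : ℝ≥0∞) : ℝ := ((n : ℝ) - 1) ^ (q⁻¹).toReal

/-- The radius of validity of the a posteriori estimate. -/
def radius (n : ℕ) (a : ℝ) : ℝ :=
  tau n * (a + 2 - tau n) / ((a + 2) * (a + 2 + (a - 1) * tau n))

/-- `α(t) = 2 / (1 - (a - 1) t + √((1 - (a - 1) t)² - 4 t))`. -/
def alpha (a t : ℝ) : ℝ :=
  2 / (1 - (a - 1) * t + √((1 - (a - 1) * t) ^ 2 - 4 * t))

end WeierstrassType

end

/-! Localization of the zeros. If `ξ` is a zero of `f`, Lagrange interpolation of `f / (X - ξ)` at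
the `x_j` gives `∑ W_j / (x_j - ξ) = 1`. For small `E_f(x)` this forces `ξ` to lie near some `x_i`,
and a quadratic inequality then yields `|x_i - ξ| ≤ α(E_f(x)) |W_i|`. Interpolating `f / ((X - ξ)(X
- η))` shows that no `x_i` has two zeros near it, so zeros and components match bijectively: this is
`exists_rootVector`. Local convergence. By `step_sub_eq`, the error after one step is the old error
times `∏ (1 + (y_j - ξ_j) / (x_i - y_j)) - 1`, which Hölder and AM-GM bound through `amp`. The
inequality `(1 + 2t)(1 + amp) ≤ 2`, valid for relative error `t ≤ τ / (a + 2)`, makes `IsClose`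
invariant. Each of the `N` inner steps contributes a factor of the order of the error, whence order
`N + 1`. The link is `radius`: it is exactly the value of `E_f` for which the localization bound
gives relative error `τ / (a + 2)`. -/

namespace WeierstrassType

/-! ### Monotonicity and Hölder bounds for the `p`-norm. -/

section PNorm

variable {E F : Type*} [NormedField E] [NormedField F] {n : ℕ} {p q : ℝ≥0∞}

theorem pNorm_top (v : Fin n → E) : pNorm ∞ v = ⨆ i, ‖v i‖ := rfl

theorem pNorm_eq_sum (hp : 1 ≤ p) (hp' : p ≠ ∞) (v : Fin n → E) :
    pNorm p v = (∑ i, ‖v i‖ ^ p.toReal) ^ (1 / p.toReal) :=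
  PiLp.norm_eq_sum (ENNReal.toReal_pos (by positivity) hp') _

theorem pNorm_nonneg (hp : 1 ≤ p) (v : Fin n → E) : 0 ≤ pNorm p v := by
  have : Fact (1 ≤ p) := ⟨hp⟩
  exact norm_nonneg (WithLp.toLp p v : PiLp p fun _ : Fin n => E)

theorem norm_apply_le_pNorm (hp : 1 ≤ p) (v : Fin n → E) (i : Fin n) : ‖v i‖ ≤ pNorm p v := by
  have : Fact (1 ≤ p) := ⟨hp⟩
  exact PiLp.norm_apply_le (WithLp.toLp p v : PiLp p fun _ : Fin n => E) i

theorem pNorm_le_mul_pNorm (hp : 1 ≤ p) {c : ℝ} (hc : 0 ≤ c) {v : Fin n → E} {w : Fin n → F}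
    (h : ∀ i, ‖v i‖ ≤ c * ‖w i‖) : pNorm p v ≤ c * pNorm p w := by
  by_cases hp' : p = ∞
  · subst hp'
    rw [pNorm_top v]
    refine Real.iSup_le (fun i => (h i).trans ?_) (mul_nonneg hc (pNorm_nonneg hp w))
    exact mul_le_mul_of_nonneg_left (norm_apply_le_pNorm hp w i) hc
  · have hr : 0 < p.toReal := ENNReal.toReal_pos (by positivity) hp'
    rw [pNorm_eq_sum hp hp', pNorm_eq_sum hp hp', ← Real.rpow_le_rpow_iff (z := p.toReal)
      (by positivity) (by positivity) hr, Real.mul_rpow hc (by positivity), ← Real.rpow_mul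
      (by positivity), ← Real.rpow_mul (by positivity), one_div_mul_cancel hr.ne', Real.rpow_one,
      Real.rpow_one, Finset.mul_sum]
    refine Finset.sum_le_sum fun i _ => ?_
    rw [← Real.mul_rpow hc (norm_nonneg _)]
    exact Real.rpow_le_rpow (norm_nonneg _) (h i) hr.le

/-- Hölder against the constant vector `1` on `n - 1` indices; this is the origin of `a = (n -
1)^{1/q}`. The endpoints `p = ∞` and `p = 1` are treated directly. -/
theorem sum_erase_norm_le (hn : 2 ≤ n) (hp : 1 ≤ p) (hpq : p⁻¹ + q⁻¹ = 1) (v : Fin n → E)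
    (i : Fin n) : ∑ j ∈ Finset.univ.erase i, ‖v j‖ ≤ aConst n q * pNorm p v := by
  have hcard : ((Finset.univ.erase i).card : ℝ) = (n : ℝ) - 1 := by
    rw [Finset.card_erase_of_mem (Finset.mem_univ _), Finset.card_univ, Fintype.card_fin,
      Nat.cast_sub (by omega), Nat.cast_one]
  by_cases hp' : p = ∞
  · subst hp'
    have hq : q = 1 := by simpa using hpq
    subst hq
    have := Finset.sum_le_card_nsmul (Finset.univ.erase i) (fun j => ‖v j‖) (pNorm ∞ v)
      (fun j _ => norm_apply_le_pNorm hp v j)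
    rw [nsmul_eq_mul, hcard] at this
    simpa [aConst] using this
  by_cases hp1 : p = 1
  · subst hp1
    have hq : q = ∞ := by
      have h1 : (1 : ℝ≥0∞) + q⁻¹ = 1 + 0 := by simpa using hpq
      simpa using (ENNReal.add_right_inj ENNReal.one_ne_top).1 h1
    subst hq
    rw [pNorm_eq_sum hp hp']
    simp only [aConst, ENNReal.inv_top, ENNReal.toReal_zero, Real.rpow_zero, one_mul,
      ENNReal.toReal_one, Real.rpow_one, div_one]
    exact Finset.sum_le_sum_of_subset_of_nonneg (Finset.erase_subset _ _)
      fun _ _ _ => norm_nonneg _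
  · have hp1' : 1 < p := lt_of_le_of_ne hp (Ne.symm hp1)
    have hq0 : q ≠ 0 := by rintro rfl; simp at hpq
    have hqt : q ≠ ∞ := by
      rintro rfl
      simp [hp1] at hpq
    have hr : p.toReal⁻¹ + q.toReal⁻¹ = 1 := by
      have := congrArg ENNReal.toReal hpq
      rwa [ENNReal.toReal_add (by simp; positivity) (by simpa using hq0), ENNReal.toReal_inv,
        ENNReal.toReal_inv, ENNReal.toReal_one] at this
    have hpr : 1 < p.toReal := by
      rw [← ENNReal.toReal_one]
      exact (ENNReal.toReal_lt_toReal ENNReal.one_ne_top hp').2 hp1'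
    have hconj : p.toReal.HolderConjugate q.toReal :=
      (Real.holderConjugate_iff).2 ⟨hpr, hr⟩
    have := Real.inner_le_Lp_mul_Lq_of_nonneg (Finset.univ.erase i) (f := fun j => ‖v j‖)
      (g := fun _ => (1 : ℝ)) hconj (fun _ _ => norm_nonneg _) (fun _ _ => zero_le_one)
    simp only [mul_one, Real.one_rpow, Finset.sum_const, nsmul_eq_mul, hcard] at this
    refine this.trans ?_
    rw [pNorm_eq_sum hp hp', aConst, ENNReal.toReal_inv, mul_comm, one_div q.toReal]
    have hn1 : (0 : ℝ) ≤ (n : ℝ) - 1 := by rw [← hcard]; positivity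
    refine mul_le_mul_of_nonneg_left ?_ (Real.rpow_nonneg hn1 _)
    refine Real.rpow_le_rpow (by positivity) ?_ (by positivity)
    exact Finset.sum_le_sum_of_subset_of_nonneg (Finset.erase_subset _ _)
      fun _ _ _ => by positivity

theorem one_le_aConst (hn : 2 ≤ n) (q : ℝ≥0∞) : 1 ≤ aConst n q := by
  have : (2 : ℝ) ≤ n := by exact_mod_cast hn
  exact Real.one_le_rpow (by linarith) ENNReal.toReal_nonneg

end PNorm

/-! ### Distances between components. -/

section MinDist

variable {K : Type*} [NormedField K] {n : ℕ}

theorem minDist_le (x : Fin n → K) {i j : Fin n} (h : j ≠ i) : minDist x i ≤ ‖x i - x j‖ :=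
  ciInf_le (Set.finite_range fun j : {j : Fin n // j ≠ i} => ‖x i - x j‖).bddBelow ⟨j, h⟩

theorem minDist_le' (x : Fin n → K) {i j : Fin n} (h : j ≠ i) : minDist x j ≤ ‖x i - x j‖ := by
  rw [norm_sub_rev]; exact minDist_le x h.symm

theorem le_minDist (hn : 2 ≤ n) (x : Fin n → K) {i : Fin n} {c : ℝ}
    (h : ∀ j, j ≠ i → c ≤ ‖x i - x j‖) : c ≤ minDist x i := by
  have : Nontrivial (Fin n) := Fin.nontrivial_iff_two_le.2 hn
  have : Nonempty {j : Fin n // j ≠ i} := by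
    obtain ⟨j, hj⟩ := exists_ne i
    exact ⟨⟨j, hj⟩⟩
  exact le_ciInf fun j => h j j.2

theorem minDist_pos (hn : 2 ≤ n) {x : Fin n → K} (hx : Function.Injective x) (i : Fin n) :
    0 < minDist x i := by
  have : Nontrivial (Fin n) := Fin.nontrivial_iff_two_le.2 hn
  have : Nonempty {j : Fin n // j ≠ i} := by
    obtain ⟨j, hj⟩ := exists_ne i
    exact ⟨⟨j, hj⟩⟩
  obtain ⟨j, hj⟩ := exists_eq_ciInf_of_finite (f := fun j : {j : Fin n // j ≠ i} => ‖x i - x j‖)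
  rw [minDist, ← hj, norm_pos_iff, sub_ne_zero]
  exact fun h => j.2 (hx h).symm

end MinDist

/-! ### The constant `τ` and the amplification factor. -/

section Reals

variable {n : ℕ}

theorem prod_one_add_le {ι : Type*} (s : Finset ι) (c : ι → ℝ) (hc : ∀ i ∈ s, 0 ≤ c i) :
    ∏ i ∈ s, (1 + c i) ≤ (1 + (∑ i ∈ s, c i) / s.card) ^ s.card := by
  rcases s.eq_empty_or_nonempty with rfl | hs
  · simp
  have h0 : (0 : ℝ) < s.card := by exact_mod_cast hs.card_pos
  have hP : 0 ≤ ∏ i ∈ s, (1 + c i) := Finset.prod_nonneg fun i hi => by linarith [hc i hi]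
  have := Real.geom_mean_le_arith_mean s (fun _ => (1 : ℝ)) (fun i => 1 + c i)
    (fun _ _ => zero_le_one) (by simpa using hs) (fun i hi => by linarith [hc i hi])
  simp only [Real.rpow_one, Finset.sum_const, nsmul_eq_mul, mul_one, one_mul,
    Finset.sum_add_distrib] at this
  rw [add_div, div_self h0.ne'] at this
  calc ∏ i ∈ s, (1 + c i) = ((∏ i ∈ s, (1 + c i)) ^ ((s.card : ℝ)⁻¹)) ^ s.card :=
        (Real.rpow_inv_natCast_pow hP hs.card_pos.ne').symm
    _ ≤ _ := pow_le_pow_left₀ (Real.rpow_nonneg hP _) this _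

/-- Convexity of the power on the segment from `1` to `1 + s`. -/
theorem one_add_mul_pow_le {c s : ℝ} (hc : 0 ≤ c) (hc1 : c ≤ 1) (hs : 0 ≤ s) (m : ℕ) :
    (1 + c * s) ^ m - 1 ≤ c * ((1 + s) ^ m - 1) := by
  have h := (convexOn_pow (𝕜 := ℝ) m).2 (Set.mem_Ici.2 (zero_le_one : (0 : ℝ) ≤ 1))
    (Set.mem_Ici.2 (by linarith : 0 ≤ 1 + s)) (by linarith : 0 ≤ 1 - c) hc (by ring)
  simp only [smul_eq_mul, one_pow, mul_one] at h
  have e : 1 - c + c * (1 + s) = 1 + c * s := by ring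
  rw [e] at h
  linarith

theorem tau_pos (hn : 2 ≤ n) : 0 < tau n := by
  have h0 : (0 : ℝ) < n := by positivity
  have : (1 : ℝ) < 2 ^ (1 / (n : ℝ)) := Real.one_lt_rpow (by norm_num) (by positivity)
  exact mul_pos h0 (by linarith)

theorem one_add_tau_div_pow (hn : 2 ≤ n) : (1 + tau n / n) ^ n = 2 := by
  have h0 : (n : ℝ) ≠ 0 := by positivity
  rw [tau, mul_div_cancel_left₀ _ h0, add_sub_cancel, one_div,
    Real.rpow_inv_natCast_pow (by norm_num) (by omega)]

theorem tau_le_one (hn : 2 ≤ n) : tau n ≤ 1 := by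
  have h0 : (0 : ℝ) < n := by positivity
  have h := one_add_mul_le_pow (a := tau n / n) (by
    have := div_pos (tau_pos hn) h0
    linarith) n
  rw [one_add_tau_div_pow hn, mul_div_cancel₀ _ h0.ne'] at h
  linarith

/-- The amplification factor `(1 + a t / (n - 1))^(n - 1) - 1` of one step of the iteration. -/
noncomputable def amp (n : ℕ) (a t : ℝ) : ℝ := (1 + a * t / (n - 1 : ℕ)) ^ (n - 1) - 1

variable {a t : ℝ}

theorem amp_nonneg (ha : 0 ≤ a) (ht : 0 ≤ t) : 0 ≤ amp n a t := by
  have : (1 : ℝ) ≤ (1 + a * t / (n - 1 : ℕ)) ^ (n - 1) :=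
    one_le_pow₀ (le_add_of_nonneg_right (by positivity))
  unfold amp
  linarith

theorem amp_mul_le {c : ℝ} (ha : 0 ≤ a) (ht : 0 ≤ t) (hc : 0 ≤ c) (hc1 : c ≤ 1) :
    amp n a (c * t) ≤ c * amp n a t := by
  have h := one_add_mul_pow_le hc hc1 (s := a * t / (n - 1 : ℕ)) (by positivity) (n - 1)
  unfold amp
  convert h using 4
  ring

theorem one_add_two_mul_mul_one_add_amp_le (hn : 2 ≤ n) (ha : 0 ≤ a) (ht : 0 ≤ t)
    (htR : t ≤ tau n / (a + 2)) : (1 + 2 * t) * (1 + amp n a t) ≤ 2 := by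
  obtain ⟨m, rfl⟩ : ∃ m, n = m + 1 := ⟨n - 1, by omega⟩
  have hm : (m : ℝ) ≠ 0 := by
    have : m ≠ 0 := by omega
    exact_mod_cast this
  -- AM-GM for the `n` factors `1 + 2t` and `n - 1` copies of `1 + a t / (n - 1)`: the increments
  -- sum to `(a + 2) t ≤ τ`, and `(1 + τ / n)^n = 2`.
  have h := prod_one_add_le (Finset.univ : Finset (Fin (m + 1)))
    (Fin.cons (2 * t) fun _ => a * t / m) (fun i _ => by
      refine Fin.cases ?_ (fun j => ?_) i
      · simp only [Fin.cons_zero]; positivity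
      · simp only [Fin.cons_succ]; positivity)
  rw [Fin.prod_univ_succ, Fin.sum_univ_succ] at h
  simp only [Fin.cons_zero, Fin.cons_succ, Finset.prod_const, Finset.sum_const, Finset.card_univ,
    Fintype.card_fin, nsmul_eq_mul, mul_div_cancel₀ _ hm] at h
  have e : amp (m + 1) a t = (1 + a * t / m) ^ m - 1 := rfl
  rw [e, add_sub_cancel]
  refine h.trans (le_of_le_of_eq ?_ (one_add_tau_div_pow hn))
  have h3 : 2 * t + a * t ≤ tau (m + 1) := by
    have := (le_div_iff₀ (by linarith)).1 htR
    linarith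
  exact pow_le_pow_left₀ (by positivity) (by gcongr) _

theorem one_add_two_mul_mul_amp_le (hn : 2 ≤ n) (ha : 0 ≤ a) (ht : 0 ≤ t)
    (htR : t ≤ tau n / (a + 2)) : (1 + 2 * t) * amp n a t ≤ 1 - 2 * t := by
  linarith [one_add_two_mul_mul_one_add_amp_le hn ha ht htR]

end Reals

/-! ### The quadratic behind `α`. -/

section Alpha

variable {a t : ℝ}

/-- Here `b` is the larger root of the quadratic; the roots have product `t`, so `α(t) t = t / b` is
the smaller one. The hypothesis `(a + 1) t < 1/2` says that the discriminant exceeds `((a - 1) t)²`,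
which puts `1/2` between the roots. -/
theorem exists_alpha_eq (ha : 1 ≤ a) (ht : 0 ≤ t) (hat : (a + 1) * t < 1 / 2) :
    ∃ b : ℝ, 1 / 2 < b ∧ alpha a t = 1 / b ∧ b ^ 2 - (1 - (a - 1) * t) * b + t = 0 := by
  have h0 : 0 ≤ (a - 1) * t := mul_nonneg (by linarith) ht
  have h1 : ((a - 1) * t) ^ 2 < (1 - (a - 1) * t) ^ 2 - 4 * t := by nlinarith
  have h2 : (a - 1) * t < √((1 - (a - 1) * t) ^ 2 - 4 * t) := Real.lt_sqrt_of_sq_lt h1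
  have h3 := Real.sq_sqrt ((sq_nonneg _).trans h1.le)
  set s := √((1 - (a - 1) * t) ^ 2 - 4 * t) with hs
  refine ⟨(1 - (a - 1) * t + s) / 2, by linarith, ?_, ?_⟩
  · rw [alpha, ← hs, one_div_div]
  · linear_combination h3 / 4

theorem alpha_nonneg (ha : 1 ≤ a) (ht : 0 ≤ t) (hat : (a + 1) * t < 1 / 2) :
    0 ≤ alpha a t := by
  obtain ⟨b, hb, h, -⟩ := exists_alpha_eq ha ht hat
  rw [h]
  positivity

theorem alpha_mul_self_eq (ha : 1 ≤ a) (ht : 0 ≤ t) (hat : (a + 1) * t < 1 / 2) :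
    (alpha a t * t) ^ 2 - (1 - (a - 1) * t) * (alpha a t * t) + t = 0 ∧
      alpha a t * t < 1 / 2 := by
  obtain ⟨b, hb, h, hq⟩ := exists_alpha_eq ha ht hat
  have hb0 : b ≠ 0 := by positivity
  have e : alpha a t * t = 1 - (a - 1) * t - b := by
    rw [h]
    field_simp
    linear_combination hq
  have h0 : 0 ≤ (a - 1) * t := mul_nonneg (by linarith) ht
  rw [e]
  exact ⟨by linear_combination hq, by linarith⟩

/-- `α(t) t` is bounded by every point at which the defining quadratic is nonpositive. -/
theorem alpha_mul_self_le {r : ℝ} (ha : 1 ≤ a) (ht : 0 ≤ t) (hat : (a + 1) * t < 1 / 2)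
    (hr : r ^ 2 - (1 - (a - 1) * t) * r + t ≤ 0) : alpha a t * t ≤ r := by
  obtain ⟨b, hb, h, hq⟩ := exists_alpha_eq ha ht hat
  have hb0 : b ≠ 0 := by positivity
  have e : alpha a t * t = 1 - (a - 1) * t - b := by
    rw [h]
    field_simp
    linear_combination hq
  obtain ⟨-, hs⟩ := alpha_mul_self_eq ha ht hat
  by_contra! hlt
  have : 0 < (r - alpha a t * t) * (r - b) := mul_pos_of_neg_of_neg (by linarith) (by linarith)
  rw [e] at this
  nlinarith

/-- Contradicts `one_sub_sq_le_of_two_roots` with `s = α(t) t`, which excludes two zeros near one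
component. -/
theorem mul_lt_one_sub_alpha_mul_sq (ha : 1 ≤ a) (ht : 0 ≤ t) (hat : (a + 1) * t < 1 / 2) :
    a * t < (1 - alpha a t * t) ^ 2 := by
  obtain ⟨b, hb, h, hq⟩ := exists_alpha_eq ha ht hat
  have hb0 : b ≠ 0 := by positivity
  have e : alpha a t * t = 1 - (a - 1) * t - b := by
    rw [h]
    field_simp
    linear_combination hq
  obtain ⟨hs, hs2⟩ := alpha_mul_self_eq ha ht hat
  have h0 : 0 ≤ (a - 1) * t := mul_nonneg (by linarith) ht
  have h3 : alpha a t * t * (1 + (a - 1) * t) ≤ (1 - (a - 1) * t) / 2 * (1 + (a - 1) * t) :=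
    mul_le_mul_of_nonneg_right (by linarith) (by linarith)
  nlinarith [sq_nonneg ((a - 1) * t)]

theorem le_alpha_mul {r d w : ℝ} (ha : 1 ≤ a) (ht : 0 ≤ t) (hat : (a + 1) * t < 1 / 2)
    (hd : 0 < d) (hr : 0 ≤ r) (hrd : 2 * r ≤ d) (hw : w ≤ t * d)
    (h : r * (d - r - a * t * d) ≤ w * (d - r)) : r ≤ alpha a t * w := by
  obtain ⟨b, hb, hα, hq⟩ := exists_alpha_eq ha ht hat
  have hb0 : 0 < b := by positivity
  -- With `w ≤ t d` the ratio `r / d` cannot lie strictly between the roots of the quadratic; as `r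
  -- / d ≤ 1/2 < b`, it is at most the smaller root. Fed back into `h`, this bound gives `b r ≤ w`.
  have h1 : 0 ≤ r ^ 2 - (1 - (a - 1) * t) * r * d + t * d ^ 2 := by nlinarith
  have h2 : r ≤ (1 - (a - 1) * t - b) * d := by
    by_contra! hlt
    have : 0 < (r - (1 - (a - 1) * t - b) * d) * (b * d - r) :=
      mul_pos (by linarith) (by nlinarith)
    nlinarith
  have h3 : b * r * (d - r) ≤ r * (d - r - a * t * d) := by
    have e : d - r - a * t * d - b * (d - r) =
        (1 - b) * ((1 - (a - 1) * t - b) * d - r) + (b ^ 2 - (1 - (a - 1) * t) * b + t) * (-d) := by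
      ring
    have hb1 : b ≤ 1 := by
      have h0 : 0 ≤ (a - 1) * t := mul_nonneg (by linarith) ht
      nlinarith
    have : 0 ≤ d - r - a * t * d - b * (d - r) := by
      rw [e, hq, zero_mul, add_zero]
      exact mul_nonneg (by linarith) (by linarith)
    nlinarith
  have h4 : b * r ≤ w := le_of_mul_le_mul_right (h3.trans h) (by linarith)
  rw [hα, one_div_mul_eq_div, le_div_iff₀ hb0]
  linarith

end Alpha

/-! ### Partial fraction identities for the Weierstrass corrections. -/

section Lagrange

open Polynomial

variable {K : Type*} [NormedField K] {n : ℕ} {f : K[X]} {x : Fin n → K}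

theorem prod_erase_sub_ne_zero (hx : Function.Injective x) (i : Fin n) :
    ∏ j ∈ Finset.univ.erase i, (x i - x j) ≠ 0 :=
  Finset.prod_ne_zero_iff.2 fun _ hj => sub_ne_zero.2 (hx.ne (Finset.ne_of_mem_erase hj).symm)

/-- The cofactor of `X - ξ` has degree `n - 1`, so Lagrange interpolation at all `n` nodes recovers
its leading coefficient, which is that of `f`. -/
theorem sum_weierstrassCorrection_div (hf : f ≠ 0) (hn : f.natDegree = n)
    (hx : Function.Injective x) {ξ : K} (hξ : f.IsRoot ξ) (hne : ∀ j, x j ≠ ξ) :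
    ∑ j, weierstrassCorrection f x j / (x j - ξ) = 1 := by
  obtain ⟨h, rfl⟩ := dvd_iff_isRoot.2 hξ
  have hh : h ≠ 0 := right_ne_zero_of_mul hf
  have hl : ((X - C ξ) * h).leadingCoeff = h.leadingCoeff := by
    rw [leadingCoeff_mul, leadingCoeff_X_sub_C, one_mul]
  have hd : (Finset.univ : Finset (Fin n)).card = h.degree + 1 := by
    rw [natDegree_mul (X_sub_C_ne_zero ξ) hh, natDegree_X_sub_C] at hn
    rw [degree_eq_natDegree hh, Finset.card_univ, Fintype.card_fin, ← hn]
    push_cast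
    ring
  have hs := Lagrange.leadingCoeff_eq_sum (s := Finset.univ) (v := x) hx.injOn hd
  have hl0 := leadingCoeff_ne_zero.2 hh
  rw [← div_self hl0]
  conv_rhs => rw [hs, Finset.sum_div]
  refine Finset.sum_congr rfl fun j _ => ?_
  have hP := prod_erase_sub_ne_zero hx j
  have hj := sub_ne_zero.2 (hne j)
  rw [← hs, weierstrassCorrection, hl, eval_mul, eval_sub, eval_X, eval_C]
  field_simp

/-- The cofactor now has degree `n - 2`, so the node `x i` is dropped; the factor `x j - x i`
compensates for it in the denominator of `W_j`. -/
theorem sum_erase_weierstrassCorrection_mul_div (hf : f ≠ 0) (hn : f.natDegree = n)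
    (hx : Function.Injective x) {ξ η : K} (hdvd : (X - C ξ) * (X - C η) ∣ f) (i : Fin n)
    (hξ : ∀ j, j ≠ i → x j ≠ ξ) (hη : ∀ j, j ≠ i → x j ≠ η) :
    ∑ j ∈ Finset.univ.erase i,
      weierstrassCorrection f x j * (x j - x i) / ((x j - ξ) * (x j - η)) = 1 := by
  obtain ⟨h, rfl⟩ := hdvd
  have hh : h ≠ 0 := right_ne_zero_of_mul hf
  have hl : ((X - C ξ) * (X - C η) * h).leadingCoeff = h.leadingCoeff := by
    rw [leadingCoeff_mul, leadingCoeff_mul, leadingCoeff_X_sub_C, leadingCoeff_X_sub_C, one_mul,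
      one_mul]
  have hd : (Finset.univ.erase i).card = h.degree + 1 := by
    rw [natDegree_mul (left_ne_zero_of_mul hf) hh, natDegree_mul (X_sub_C_ne_zero ξ)
      (X_sub_C_ne_zero η), natDegree_X_sub_C, natDegree_X_sub_C] at hn
    rw [degree_eq_natDegree hh, Finset.card_erase_of_mem (Finset.mem_univ _), Finset.card_univ,
      Fintype.card_fin, show n - 1 = h.natDegree + 1 by omega]
    push_cast
    ring
  have hs := Lagrange.leadingCoeff_eq_sum (s := Finset.univ.erase i) (v := x) hx.injOn hd
  have hl0 := leadingCoeff_ne_zero.2 hh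
  rw [← div_self hl0]
  conv_rhs => rw [hs, Finset.sum_div]
  refine Finset.sum_congr rfl fun j hj => ?_
  have hji := Finset.ne_of_mem_erase hj
  have hP : ∏ k ∈ (Finset.univ.erase i).erase j, (x j - x k) ≠ 0 :=
    Finset.prod_ne_zero_iff.2 fun k hk => sub_ne_zero.2 (hx.ne (Finset.ne_of_mem_erase hk).symm)
  have h1 := sub_ne_zero.2 (hξ j hji)
  have h2 := sub_ne_zero.2 (hη j hji)
  have h3 : x j - x i ≠ 0 := sub_ne_zero.2 (hx.ne hji)
  have hprod : ∏ k ∈ Finset.univ.erase j, (x j - x k) =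
      (x j - x i) * ∏ k ∈ (Finset.univ.erase i).erase j, (x j - x k) := by
    rw [Finset.erase_right_comm, Finset.mul_prod_erase _ (fun k => x j - x k)
      (Finset.mem_erase.2 ⟨hji.symm, Finset.mem_univ _⟩)]
  rw [← hs, weierstrassCorrection, hl, hprod]
  simp only [eval_mul, eval_sub, eval_X, eval_C]
  field_simp

end Lagrange

/-! ### Zeros of `f` near the components of `x`. -/

section Localization

open Polynomial

variable {K : Type*} [NormedField K] {n : ℕ} {p q : ℝ≥0∞} {f : K[X]} {x : Fin n → K} {a : ℝ}

theorem norm_sub_mul_le_norm_sub_mul {ξ : K} {i j : Fin n} (hji : j ≠ i) {s : ℝ}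
    (h : ‖x i - ξ‖ ≤ s * minDist x i) (hs : 0 ≤ s) : (1 - s) * ‖x i - x j‖ ≤ ‖x j - ξ‖ := by
  have h1 : ‖x i - x j‖ ≤ ‖x i - ξ‖ + ‖x j - ξ‖ := by
    rw [norm_sub_rev (x j)]
    exact norm_sub_le_norm_sub_add_norm_sub _ _ _
  have h2 := mul_le_mul_of_nonneg_left (minDist_le x hji) hs
  linarith

theorem norm_initialFun_apply_le (hn : 2 ≤ n) (hp : 1 ≤ p) (hx : Function.Injective x)
    (i : Fin n) : ‖weierstrassCorrection f x i‖ ≤ initialFun p f x * minDist x i := by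
  have hd := minDist_pos hn hx i
  have h := norm_apply_le_pNorm hp (fun i => ‖weierstrassCorrection f x i‖ / minDist x i) i
  rwa [Real.norm_of_nonneg (by positivity), div_le_iff₀ hd] at h

theorem sum_erase_initialFun_le (hn : 2 ≤ n) (hp : 1 ≤ p) (hpq : p⁻¹ + q⁻¹ = 1)
    (hx : Function.Injective x) (i : Fin n) :
    ∑ j ∈ Finset.univ.erase i, ‖weierstrassCorrection f x j‖ / minDist x j ≤
      aConst n q * initialFun p f x := by
  refine le_trans (le_of_eq (Finset.sum_congr rfl fun j _ => ?_)) (sum_erase_norm_le hn hp hpq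
    (fun i => ‖weierstrassCorrection f x i‖ / minDist x i) i)
  rw [Real.norm_of_nonneg (div_nonneg (norm_nonneg _) (minDist_pos hn hx j).le)]

theorem initialFun_nonneg (hp : 1 ≤ p) : 0 ≤ initialFun p f x := pNorm_nonneg hp _

theorem exists_two_mul_norm_sub_le_minDist (hn : 2 ≤ n) (hp : 1 ≤ p) (hpq : p⁻¹ + q⁻¹ = 1)
    (hf : f ≠ 0) (hdeg : f.natDegree = n) (hx : Function.Injective x)
    (hE : (aConst n q + 1) * initialFun p f x < 1 / 2) {ξ : K} (hξ : f.IsRoot ξ) :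
    ∃ i, 2 * ‖x i - ξ‖ ≤ minDist x i := by
  by_contra! h
  have hd := minDist_pos hn hx
  have hpos : ∀ j, 0 < ‖x j - ξ‖ := fun j => by linarith [h j, hd j]
  have hsum := sum_weierstrassCorrection_div hf hdeg hx hξ fun j =>
    sub_ne_zero.1 (norm_pos_iff.1 (hpos j))
  -- Any index would do: Hölder covers `n - 1` summands and the remaining one is at most `E_f(x)`,
  -- giving the factor `a + 1`.
  let i : Fin n := ⟨0, by omega⟩
  have h1 : (1 : ℝ) ≤ ∑ j, 2 * (‖weierstrassCorrection f x j‖ / minDist x j) := by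
    have h0 := congrArg norm hsum
    rw [norm_one] at h0
    refine h0.ge.trans ?_
    refine norm_sum_le_of_le _ fun j _ => ?_
    rw [norm_div, div_le_iff₀ (hpos j), ← mul_div_assoc, div_mul_eq_mul_div, le_div_iff₀ (hd j)]
    nlinarith [norm_nonneg (weierstrassCorrection f x j), h j]
  rw [← Finset.mul_sum, ← Finset.add_sum_erase _ _ (Finset.mem_univ i)] at h1
  have h2 := sum_erase_initialFun_le (f := f) hn hp hpq hx i
  have h3 := (div_le_iff₀ (hd i)).2 (norm_initialFun_apply_le (f := f) hn hp hx i)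
  linarith

theorem norm_sub_root_le (hn : 2 ≤ n) (hp : 1 ≤ p) (hpq : p⁻¹ + q⁻¹ = 1)
    (hf : f ≠ 0) (hdeg : f.natDegree = n) (hx : Function.Injective x)
    (hE : (aConst n q + 1) * initialFun p f x < 1 / 2) {ξ : K} (hξ : f.IsRoot ξ) {i : Fin n}
    (hi : 2 * ‖x i - ξ‖ ≤ minDist x i) :
    ‖x i - ξ‖ ≤ alpha (aConst n q) (initialFun p f x) * ‖weierstrassCorrection f x i‖ := by
  have hd := minDist_pos hn hx
  have ha := one_le_aConst hn q
  have hE0 : 0 ≤ initialFun p f x := initialFun_nonneg hp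
  rcases eq_or_ne (x i) ξ with hxi | hxi
  · rw [hxi, sub_self, norm_zero]
    exact mul_nonneg (alpha_nonneg ha hE0 hE) (norm_nonneg _)
  refine le_alpha_mul ha hE0 hE (hd i) (norm_nonneg _) hi
    (norm_initialFun_apply_le hn hp hx i) ?_
  set r := ‖x i - ξ‖ with hr
  set d := minDist x i with hdi
  have hr0 : 0 < r := norm_pos_iff.2 (sub_ne_zero.2 hxi)
  have hdr : 0 < d - r := by linarith [hd i]
  have hlow : ∀ j, j ≠ i → (1 - r / d) * ‖x i - x j‖ ≤ ‖x j - ξ‖ := fun j hj =>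
    norm_sub_mul_le_norm_sub_mul hj (div_mul_cancel₀ _ (hd i).ne').ge
      (div_nonneg hr0.le (hd i).le)
  have hrd : 1 - r / d = (d - r) / d := by rw [sub_div, div_self (hd i).ne']
  have hc : 0 < 1 - r / d := by rw [hrd]; exact div_pos hdr (hd i)
  have hlow' : ∀ j, j ≠ i → (1 - r / d) * minDist x j ≤ ‖x j - ξ‖ := fun j hj =>
    (mul_le_mul_of_nonneg_left (minDist_le' x hj) hc.le).trans (hlow j hj)
  have hpos : ∀ j, x j ≠ ξ := fun j => by
    rcases eq_or_ne j i with rfl | hj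
    · exact hxi
    · exact sub_ne_zero.1 (norm_pos_iff.1 ((mul_pos hc (hd j)).trans_le (hlow' j hj)))
  have hsum := sum_weierstrassCorrection_div hf hdeg hx hξ hpos
  rw [← Finset.add_sum_erase _ _ (Finset.mem_univ i)] at hsum
  -- The `i`-th term is kept exact and only the others are estimated, so that `|W_i|` survives in
  -- the final bound.
  have h1 : (1 : ℝ) ≤ ‖weierstrassCorrection f x i‖ / r +
      ∑ j ∈ Finset.univ.erase i,
        (1 - r / d)⁻¹ * (‖weierstrassCorrection f x j‖ / minDist x j) := by
    have h0 := congrArg norm hsum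
    rw [norm_one] at h0
    refine h0.ge.trans ?_
    refine (norm_add_le _ _).trans (add_le_add (norm_div _ _).le ?_)
    refine norm_sum_le_of_le _ fun j hj => ?_
    rw [norm_div, ← div_eq_inv_mul, div_div, mul_comm (minDist x j)]
    exact div_le_div_of_nonneg_left (norm_nonneg _) (mul_pos hc (hd j))
      (hlow' j (Finset.ne_of_mem_erase hj))
  rw [← Finset.mul_sum] at h1
  have h2 := mul_le_mul_of_nonneg_left (sum_erase_initialFun_le (f := f) hn hp hpq hx i)
    (inv_nonneg.2 hc.le)
  have h3 := h1.trans (add_le_add_right h2 _)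
  rw [hrd, inv_div, div_mul_eq_mul_div, div_add_div _ _ hr0.ne' hdr.ne',
    le_div_iff₀ (mul_pos hr0 hdr)] at h3
  linarith

theorem one_sub_sq_le_of_two_roots (hn : 2 ≤ n) (hp : 1 ≤ p) (hpq : p⁻¹ + q⁻¹ = 1)
    (hf : f ≠ 0) (hdeg : f.natDegree = n) (hx : Function.Injective x) {ξ η : K}
    (hdvd : (X - C ξ) * (X - C η) ∣ f) {i : Fin n} {s : ℝ} (hs : 0 ≤ s) (hs1 : s < 1)
    (hξ : ‖x i - ξ‖ ≤ s * minDist x i) (hη : ‖x i - η‖ ≤ s * minDist x i) :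
    (1 - s) ^ 2 ≤ aConst n q * initialFun p f x := by
  have hd := minDist_pos hn hx
  have hc : 0 < 1 - s := by linarith
  have hpos : ∀ ζ : K, ‖x i - ζ‖ ≤ s * minDist x i → ∀ j, j ≠ i → x j ≠ ζ := fun ζ h j hj =>
    sub_ne_zero.1 (norm_pos_iff.1 ((mul_pos hc (norm_pos_iff.2 (sub_ne_zero.2
      (hx.ne hj.symm)))).trans_le (norm_sub_mul_le_norm_sub_mul hj h hs)))
  have hsum := sum_erase_weierstrassCorrection_mul_div hf hdeg hx hdvd i (hpos ξ hξ) (hpos η hη)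
  have h1 : (1 : ℝ) ≤ ∑ j ∈ Finset.univ.erase i,
      ((1 - s) ^ 2)⁻¹ * (‖weierstrassCorrection f x j‖ / minDist x j) := by
    have h0 := congrArg norm hsum
    rw [norm_one] at h0
    refine h0.ge.trans ?_
    refine norm_sum_le_of_le _ fun j hj => ?_
    have hj := Finset.ne_of_mem_erase hj
    have hij : 0 < ‖x i - x j‖ := norm_pos_iff.2 (sub_ne_zero.2 (hx.ne hj.symm))
    have e1 := norm_sub_mul_le_norm_sub_mul hj hξ hs
    have e2 := norm_sub_mul_le_norm_sub_mul hj hη hs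
    rw [norm_div, norm_mul, norm_mul, norm_sub_rev (x j) (x i)]
    calc ‖weierstrassCorrection f x j‖ * ‖x i - x j‖ / (‖x j - ξ‖ * ‖x j - η‖)
        ≤ ‖weierstrassCorrection f x j‖ * ‖x i - x j‖ /
            ((1 - s) * ‖x i - x j‖ * ((1 - s) * ‖x i - x j‖)) := by
          gcongr
      _ = ((1 - s) ^ 2)⁻¹ * (‖weierstrassCorrection f x j‖ / ‖x i - x j‖) := by
          field_simp
      _ ≤ _ := by
          have := minDist_le' x hj
          have := hd j
          gcongr
  rw [← Finset.mul_sum, ← div_eq_inv_mul, le_div_iff₀ (by positivity), one_mul] at h1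
  exact h1.trans (sum_erase_initialFun_le hn hp hpq hx i)

theorem exists_eq_C_mul_prod [IsAlgClosed K] (hdeg : f.natDegree = n) :
    ∃ ζ : Fin n → K, f = C f.leadingCoeff * ∏ i, (X - C (ζ i)) := by
  have hsp : f.Splits := IsAlgClosed.splits f
  have hc : f.roots.toList.length = n := by
    rw [Multiset.length_toList, ← hsp.natDegree_eq_card_roots, hdeg]
  refine ⟨fun i => f.roots.toList.get (i.cast hc.symm), ?_⟩
  conv_lhs => rw [hsp.eq_prod_roots]
  congr 1
  subst hc
  conv_lhs => rw [← Multiset.coe_toList f.roots]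
  rw [Multiset.map_coe, Multiset.prod_coe, ← List.prod_ofFn]
  congr 1
  conv_lhs => rw [← List.ofFn_get f.roots.toList, List.map_ofFn]
  rfl

/-- If `E_f(x)` is small, every component of `x` lies close to its own zero of `f`. -/
theorem exists_rootVector [IsAlgClosed K] (hn : 2 ≤ n) (hp : 1 ≤ p) (hpq : p⁻¹ + q⁻¹ = 1)
    (hdeg : f.natDegree = n) (hx : Function.Injective x)
    (hE : (aConst n q + 1) * initialFun p f x < 1 / 2) :
    ∃ ξ : Fin n → K, Function.Injective ξ ∧ f = C f.leadingCoeff * ∏ i, (X - C (ξ i)) ∧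
      ∀ i, ‖x i - ξ i‖ ≤
        alpha (aConst n q) (initialFun p f x) * ‖weierstrassCorrection f x i‖ := by
  have hf : f ≠ 0 := by rintro rfl; simp at hdeg; omega
  have ha := one_le_aConst hn q
  have hE0 : 0 ≤ initialFun p f x := initialFun_nonneg hp
  have hα := alpha_nonneg ha hE0 hE
  obtain ⟨ζ, hζ⟩ := exists_eq_C_mul_prod hdeg
  have hroot : ∀ k, f.IsRoot (ζ k) := fun k => by
    rw [hζ, ← dvd_iff_isRoot]
    exact (Finset.dvd_prod_of_mem _ (Finset.mem_univ k)).mul_left _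
  choose σ hσ using fun k => exists_two_mul_norm_sub_le_minDist hn hp hpq hf hdeg hx hE (hroot k)
  have hb := fun k => norm_sub_root_le hn hp hpq hf hdeg hx hE (hroot k) (hσ k)
  have hbd : ∀ k, ‖x (σ k) - ζ k‖ ≤ alpha (aConst n q) (initialFun p f x) * initialFun p f x *
      minDist x (σ k) := fun k => by
    rw [mul_assoc]
    exact (hb k).trans (mul_le_mul_of_nonneg_left (norm_initialFun_apply_le hn hp hx _) hα)
  -- The indices differ but the values `ζ k` and `ζ l` may coincide: only divisibility by the
  -- product of the two linear factors is needed. One estimate thus gives both the bijection and the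
  -- simplicity of the zeros.
  have hclose : ∀ k l, k ≠ l → ∀ i, ‖x i - ζ k‖ ≤ alpha (aConst n q) (initialFun p f x) *
      initialFun p f x * minDist x i → ‖x i - ζ l‖ ≤ alpha (aConst n q) (initialFun p f x) *
      initialFun p f x * minDist x i → False := by
    intro k l hkl i h1 h2
    refine (mul_lt_one_sub_alpha_mul_sq ha hE0 hE).not_ge
      (one_sub_sq_le_of_two_roots hn hp hpq hf hdeg hx (ξ := ζ k) (η := ζ l) ?_
        (mul_nonneg hα hE0) (by linarith [(alpha_mul_self_eq ha hE0 hE).2]) h1 h2)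
    conv_rhs => rw [hζ, ← Finset.mul_prod_erase _ _ (Finset.mem_univ k),
      ← Finset.mul_prod_erase _ _ (Finset.mem_erase.2 ⟨hkl.symm, Finset.mem_univ l⟩), ← mul_assoc
      (X - C (ζ k))]
    exact (dvd_mul_right _ _).mul_left _
  have hinj : Function.Injective σ := fun k l hkl => by
    by_contra hne
    exact hclose k l hne (σ k) (hbd k) (by rw [hkl]; exact hbd l)
  let e : Fin n ≃ Fin n := Equiv.ofBijective σ (Finite.injective_iff_bijective.1 hinj)
  have he : ∀ i, σ (e.symm i) = i := e.apply_symm_apply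
  refine ⟨ζ ∘ e.symm, ?_, ?_, fun i => ?_⟩
  · refine Function.Injective.comp (fun k l hkl => ?_) e.symm.injective
    by_contra hne
    exact hclose k l hne (σ k) (hbd k) (by rw [← hkl]; exact hbd k)
  · refine hζ.trans ?_
    congr 1
    exact (Equiv.prod_comp e.symm fun k => X - C (ζ k)).symm
  · have := hb (e.symm i)
    rwa [he] at this

theorem hasOnlySimpleZeros_of_eq_prod {ξ : Fin n → K} (hξ : Function.Injective ξ)
    (h : f = C f.leadingCoeff * ∏ i, (X - C (ξ i))) (hf : f ≠ 0) : HasOnlySimpleZeros f := by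
  classical
  intro z hz
  have hr : f.roots = Finset.univ.val.map ξ := by
    rw [h, roots_C_mul _ (leadingCoeff_ne_zero.2 hf), roots_prod _ _ (Finset.prod_ne_zero_iff.2
      fun i _ => X_sub_C_ne_zero _)]
    simp
  have hnd : f.roots.Nodup := by
    rw [hr]
    exact Finset.univ.nodup.map hξ
  rw [← count_roots, Multiset.count_eq_one_of_mem hnd ((mem_roots hf).2 hz)]

end Localization

/-! ### Error analysis of one step. -/

section Local

open Polynomial

variable {K : Type*} [NormedField K] {n : ℕ} {p q : ℝ≥0∞} {f : K[X]} {x ξ y : Fin n → K} {t : ℝ}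

theorem norm_prod_one_add_sub_one_le' {ι : Type*} (s : Finset ι) (z : ι → K) :
    ‖∏ i ∈ s, (1 + z i) - 1‖ ≤ ∏ i ∈ s, (1 + ‖z i‖) - 1 := by
  classical
  induction s using Finset.induction_on with
  | empty => simp
  | insert i s hi ih =>
    rw [Finset.prod_insert hi, Finset.prod_insert hi]
    have e : (1 + z i) * ∏ j ∈ s, (1 + z j) - 1 =
        (1 + z i) * (∏ j ∈ s, (1 + z j) - 1) + z i := by ring
    have h1 : ‖1 + z i‖ ≤ 1 + ‖z i‖ := (norm_add_le _ _).trans (by rw [norm_one])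
    calc _ ≤ ‖1 + z i‖ * ‖∏ j ∈ s, (1 + z j) - 1‖ + ‖z i‖ := by
          rw [e, ← norm_mul]
          exact norm_add_le _ _
      _ ≤ (1 + ‖z i‖) * (∏ j ∈ s, (1 + ‖z j‖) - 1) + ‖z i‖ := by gcongr
      _ = _ := by ring

/-- `‖(x - ξ) / d(x)‖_p`. -/
noncomputable def relErr (p : ℝ≥0∞) (x ξ : Fin n → K) : ℝ :=
  pNorm p fun i => ‖x i - ξ i‖ / minDist x i

theorem relErr_nonneg (hp : 1 ≤ p) : 0 ≤ relErr p x ξ := pNorm_nonneg hp _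

theorem norm_sub_le_relErr_mul (hn : 2 ≤ n) (hp : 1 ≤ p) (hx : Function.Injective x)
    (i : Fin n) : ‖x i - ξ i‖ ≤ relErr p x ξ * minDist x i := by
  have hd := minDist_pos hn hx i
  have h := norm_apply_le_pNorm hp (fun i => ‖x i - ξ i‖ / minDist x i) i
  rwa [Real.norm_of_nonneg (by positivity), div_le_iff₀ hd] at h

/-- After factoring `f (x i)`, each quotient `(x i - ξ j) / (x i - y j)` is `1` plus a small term.
-/
theorem step_sub_eq (hf : f ≠ 0) (hξ : f = C f.leadingCoeff * ∏ i, (X - C (ξ i))) {i : Fin n}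
    (hy : ∀ j, j ≠ i → x i ≠ y j) :
    x i - f.eval (x i) / (f.leadingCoeff * ∏ j ∈ Finset.univ.erase i, (x i - y j)) - ξ i =
      -((x i - ξ i) *
        (∏ j ∈ Finset.univ.erase i, (1 + (y j - ξ j) / (x i - y j)) - 1)) := by
  have h1 : f.eval (x i) = f.leadingCoeff * ((x i - ξ i) *
      ∏ j ∈ Finset.univ.erase i, (x i - ξ j)) := by
    conv_lhs => rw [hξ]
    rw [eval_mul, eval_C, eval_prod, ← Finset.mul_prod_erase _ _ (Finset.mem_univ i)]
    simp
  have h2 : ∏ j ∈ Finset.univ.erase i, (1 + (y j - ξ j) / (x i - y j)) =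
      (∏ j ∈ Finset.univ.erase i, (x i - ξ j)) / ∏ j ∈ Finset.univ.erase i, (x i - y j) := by
    rw [← Finset.prod_div_distrib]
    refine Finset.prod_congr rfl fun j hj => ?_
    have := sub_ne_zero.2 (hy j (Finset.ne_of_mem_erase hj))
    field_simp
    ring
  rw [h2, h1, mul_div_mul_left _ _ (leadingCoeff_ne_zero.2 hf)]
  ring

/-- The constant `κ` measures the accuracy of the inner vector `y` and `l` the loss in replacing `x
j` by `y j` in distances. Hölder and AM-GM give `amp` at `κ l` times the relative error, and
convexity pulls `κ l ≤ 1` out. -/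
theorem norm_step_sub_le (hn : 2 ≤ n) (hp : 1 ≤ p) (hpq : p⁻¹ + q⁻¹ = 1) (hf : f ≠ 0)
    (hξ : f = C f.leadingCoeff * ∏ i, (X - C (ξ i))) (hx : Function.Injective x)
    {κ l : ℝ} (hκ : 0 ≤ κ) (hl : 0 ≤ l) (hκl : κ * l ≤ 1) {i : Fin n}
    (hy : ∀ j, ‖y j - ξ j‖ ≤ κ * ‖x j - ξ j‖)
    (hxy : ∀ j, j ≠ i → ‖x i - x j‖ ≤ l * ‖x i - y j‖) :
    ‖x i - f.eval (x i) / (f.leadingCoeff * ∏ j ∈ Finset.univ.erase i, (x i - y j)) - ξ i‖ ≤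
      κ * l * amp n (aConst n q) (relErr p x ξ) * ‖x i - ξ i‖ := by
  have hd := minDist_pos hn hx
  have ha : 0 ≤ aConst n q := zero_le_one.trans (one_le_aConst hn q)
  have hpos : ∀ j, j ≠ i → 0 < ‖x i - y j‖ := fun j hj => by
    have h1 := norm_pos_iff.2 (sub_ne_zero.2 (hx.ne hj.symm))
    have h2 := h1.trans_le (hxy j hj)
    exact pos_of_mul_pos_right h2 hl
  rw [step_sub_eq hf hξ fun j hj => sub_ne_zero.1 (norm_pos_iff.1 (hpos j hj)), norm_neg,
    norm_mul, mul_comm]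
  refine mul_le_mul_of_nonneg_right ?_ (norm_nonneg _)
  refine le_trans ?_ (amp_mul_le ha (relErr_nonneg hp) (mul_nonneg hκ hl) hκl)
  refine (norm_prod_one_add_sub_one_le' _ _).trans ?_
  have hterm : ∀ j ∈ Finset.univ.erase i,
      ‖(y j - ξ j) / (x i - y j)‖ ≤ κ * l * (‖x j - ξ j‖ / minDist x j) := fun j hj => by
    have hj := Finset.ne_of_mem_erase hj
    rw [norm_div, div_le_iff₀ (hpos j hj)]
    calc ‖y j - ξ j‖ ≤ κ * ‖x j - ξ j‖ := hy j
      _ = κ * (‖x j - ξ j‖ / minDist x j) * minDist x j := by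
          rw [mul_assoc, div_mul_cancel₀ _ (hd j).ne']
      _ ≤ κ * (‖x j - ξ j‖ / minDist x j) * (l * ‖x i - y j‖) := by
          have := hd j
          exact mul_le_mul_of_nonneg_left ((minDist_le' x hj).trans (hxy j hj)) (by positivity)
      _ = _ := by ring
  have hsum : ∑ j ∈ Finset.univ.erase i, ‖x j - ξ j‖ / minDist x j ≤
      aConst n q * relErr p x ξ := by
    refine le_trans (le_of_eq (Finset.sum_congr rfl fun j _ => ?_)) (sum_erase_norm_le hn hp hpq
      (fun i => ‖x i - ξ i‖ / minDist x i) i)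
    rw [Real.norm_of_nonneg (div_nonneg (norm_nonneg _) (hd j).le)]
  have hcard : (Finset.univ.erase i).card = n - 1 := by
    rw [Finset.card_erase_of_mem (Finset.mem_univ _), Finset.card_univ, Fintype.card_fin]
  have h1 := prod_one_add_le (Finset.univ.erase i) (fun j => ‖(y j - ξ j) / (x i - y j)‖)
    fun _ _ => norm_nonneg _
  rw [hcard] at h1
  refine (sub_le_sub_right h1 1).trans ?_
  have h2 : ∑ j ∈ Finset.univ.erase i, ‖(y j - ξ j) / (x i - y j)‖ ≤
      aConst n q * (κ * l * relErr p x ξ) := by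
    refine (Finset.sum_le_sum hterm).trans ?_
    rw [← Finset.mul_sum, mul_left_comm]
    exact mul_le_mul_of_nonneg_left hsum (mul_nonneg hκ hl)
  rw [amp]
  have h3 : 0 ≤ ∑ j ∈ Finset.univ.erase i, ‖(y j - ξ j) / (x i - y j)‖ :=
    Finset.sum_nonneg fun _ _ => norm_nonneg _
  gcongr

/-- The standing hypotheses on an approximation `x` of the root-vector `ξ`. -/
structure IsClose (p q : ℝ≥0∞) (x ξ : Fin n → K) : Prop where
  injective : Function.Injective x
  relErr_le : relErr p x ξ ≤ tau n / (aConst n q + 2)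

theorem tau_div_le (hn : 2 ≤ n) {a : ℝ} (ha : 1 ≤ a) : tau n / (a + 2) ≤ 1 / 3 := by
  rw [div_le_div_iff₀ (by linarith) (by norm_num)]
  linarith [tau_le_one hn]

variable (hn : 2 ≤ n) (hp : 1 ≤ p) (hx : IsClose p q x ξ)

section
include hn hp hx

theorem IsClose.norm_error_le {i j : Fin n} (h : j ≠ i) :
    ‖x i - ξ i‖ ≤ relErr p x ξ * ‖x i - x j‖ :=
  (norm_sub_le_relErr_mul hn hp hx.injective i).trans
    (mul_le_mul_of_nonneg_left (minDist_le x h) (relErr_nonneg hp))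

theorem IsClose.norm_sub_le_mul_norm_sub_step
    (hy : ∀ j, ‖y j - ξ j‖ ≤ amp n (aConst n q) (relErr p x ξ) * ‖x j - ξ j‖) {i j : Fin n}
    (h : j ≠ i) : ‖x i - x j‖ ≤ (1 + 2 * relErr p x ξ) * ‖x i - y j‖ := by
  have ha : 0 ≤ aConst n q := zero_le_one.trans (one_le_aConst hn q)
  have ht := relErr_nonneg (x := x) (ξ := ξ) hp
  have hA := one_add_two_mul_mul_one_add_amp_le hn ha ht hx.relErr_le
  have hA0 := amp_nonneg (n := n) ha ht
  set t := relErr p x ξ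
  set β := amp n (aConst n q) t
  have h1 : ‖x i - x j‖ ≤ ‖x i - y j‖ + ‖y j - ξ j‖ + ‖x j - ξ j‖ := by
    have e : x i - x j = (x i - y j) + (y j - ξ j) - (x j - ξ j) := by ring
    rw [e]
    exact (norm_sub_le _ _).trans (add_le_add_left (norm_add_le _ _) _)
  have h2 : ‖x j - ξ j‖ ≤ t * ‖x i - x j‖ := by
    rw [norm_sub_rev (x i)]
    exact hx.norm_error_le hn hp h.symm
  have h3 : (1 + β) * ‖x j - ξ j‖ ≤ (1 + β) * (t * ‖x i - x j‖) :=
    mul_le_mul_of_nonneg_left h2 (by linarith)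
  have h4 : ‖x i - x j‖ - (1 + β) * (t * ‖x i - x j‖) ≤ ‖x i - y j‖ := by
    linarith [hy j]
  have h5 := mul_le_mul_of_nonneg_left h4 (by linarith : 0 ≤ 1 + 2 * t)
  -- From `hA`, `(1 + 2t)(1 - (1 + β) t) ≥ 1 + 2t - 2t = 1`.
  have h6 := mul_le_mul_of_nonneg_right hA (mul_nonneg ht (norm_nonneg (x i - x j)))
  linarith

theorem IsClose.norm_sub_le_mul_norm_step_sub_step
    (hy : ∀ j, ‖y j - ξ j‖ ≤ amp n (aConst n q) (relErr p x ξ) * ‖x j - ξ j‖) {i j : Fin n}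
    (h : j ≠ i) :
    (1 - 2 * relErr p x ξ) * ‖x i - x j‖ ≤ (1 + 2 * relErr p x ξ) * ‖y i - y j‖ := by
  have ha : 0 ≤ aConst n q := zero_le_one.trans (one_le_aConst hn q)
  have ht := relErr_nonneg (x := x) (ξ := ξ) hp
  have hA := one_add_two_mul_mul_one_add_amp_le hn ha ht hx.relErr_le
  have hA0 := amp_nonneg (n := n) ha ht
  set t := relErr p x ξ
  set β := amp n (aConst n q) t
  have h1 : ‖x i - x j‖ ≤ ‖y i - y j‖ + ‖y j - ξ j‖ + ‖x j - ξ j‖ + ‖y i - ξ i‖ + ‖x i - ξ i‖ := by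
    have e : x i - x j = (y i - y j) + (y j - ξ j) - (x j - ξ j) - (y i - ξ i) + (x i - ξ i) := by
      ring
    rw [e]
    refine (norm_add_le _ _).trans (add_le_add_left ((norm_sub_le _ _).trans (add_le_add_left
      ((norm_sub_le _ _).trans (add_le_add_left (norm_add_le _ _) _)) _)) _)
  have h2 : ‖x j - ξ j‖ ≤ t * ‖x i - x j‖ := by
    rw [norm_sub_rev (x i)]
    exact hx.norm_error_le hn hp h.symm
  have h3 : (1 + β) * (‖x i - ξ i‖ + ‖x j - ξ j‖) ≤ (1 + β) * (2 * t * ‖x i - x j‖) :=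
    mul_le_mul_of_nonneg_left (by linarith [hx.norm_error_le hn hp h]) (by linarith)
  have h4 : ‖x i - x j‖ - (1 + β) * (2 * t * ‖x i - x j‖) ≤ ‖y i - y j‖ := by
    linarith [hy j, hy i]
  have h5 := mul_le_mul_of_nonneg_left h4 (by linarith : 0 ≤ 1 + 2 * t)
  have h6 := mul_le_mul_of_nonneg_right hA (mul_nonneg ht (norm_nonneg (x i - x j)))
  linarith

/-- The relative error cannot grow: errors shrink by a factor at most `(1 - 2t) / (1 + 2t)`, while
minimal distances keep at least that fraction. -/
theorem IsClose.of_norm_sub_le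
    (hy : ∀ j, ‖y j - ξ j‖ ≤ amp n (aConst n q) (relErr p x ξ) * ‖x j - ξ j‖) :
    IsClose p q y ξ := by
  have ha := one_le_aConst hn q
  have ht := relErr_nonneg (x := x) (ξ := ξ) hp
  have ht3 := hx.relErr_le.trans (tau_div_le hn ha)
  have hg := one_add_two_mul_mul_amp_le hn (zero_le_one.trans ha) ht hx.relErr_le
  have hA0 := amp_nonneg (n := n) (zero_le_one.trans ha) ht
  have hsep := fun i j (h : j ≠ i) => hx.norm_sub_le_mul_norm_step_sub_step hn hp hy h
  have hinj : Function.Injective y := fun i j hij => by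
    by_contra hne
    have h1 := hsep i j (Ne.symm hne)
    rw [hij, sub_self, norm_zero, mul_zero] at h1
    have h2 := norm_pos_iff.2 (sub_ne_zero.2 (hx.injective.ne hne))
    nlinarith
  refine ⟨hinj, le_trans ?_ hx.relErr_le⟩
  have hd := minDist_pos hn hx.injective
  have hd' := minDist_pos hn hinj
  rw [← one_mul (relErr p x ξ)]
  refine pNorm_le_mul_pNorm hp zero_le_one fun i => ?_
  have := hd i
  have := hd' i
  rw [one_mul, Real.norm_of_nonneg (by positivity), Real.norm_of_nonneg (by positivity),
    div_le_div_iff₀ (hd' i) (hd i)]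
  set t := relErr p x ξ
  have h1 : (1 - 2 * t) / (1 + 2 * t) * minDist x i ≤ minDist y i :=
    le_minDist hn y fun j hj => by
      rw [div_mul_eq_mul_div, div_le_iff₀ (by linarith), mul_comm ‖y i - y j‖]
      exact (mul_le_mul_of_nonneg_left (minDist_le x hj) (by linarith)).trans (hsep i j hj)
  have h2 : amp n (aConst n q) t ≤ (1 - 2 * t) / (1 + 2 * t) := by
    rw [le_div_iff₀ (by linarith)]
    linarith
  calc ‖y i - ξ i‖ * minDist x i
      ≤ (1 - 2 * t) / (1 + 2 * t) * ‖x i - ξ i‖ * minDist x i :=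
        mul_le_mul_of_nonneg_right ((hy i).trans (mul_le_mul_of_nonneg_right h2 (norm_nonneg _)))
          (hd i).le
    _ = ‖x i - ξ i‖ * ((1 - 2 * t) / (1 + 2 * t) * minDist x i) := by ring
    _ ≤ _ := mul_le_mul_of_nonneg_left h1 (norm_nonneg _)

theorem IsClose.norm_root_sub_root_le {i j : Fin n} (h : j ≠ i) :
    ‖ξ i - ξ j‖ ≤ 2 * ‖x i - x j‖ := by
  have ht3 := hx.relErr_le.trans (tau_div_le hn (one_le_aConst hn q))
  have h1 : ‖ξ i - ξ j‖ ≤ ‖x i - x j‖ + ‖x i - ξ i‖ + ‖x j - ξ j‖ := by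
    have e : ξ i - ξ j = (x i - x j) - (x i - ξ i) + (x j - ξ j) := by ring
    rw [e]
    exact (norm_add_le _ _).trans (add_le_add_left (norm_sub_le _ _) _)
  have h2 : ‖x j - ξ j‖ ≤ relErr p x ξ * ‖x i - x j‖ := by
    rw [norm_sub_rev (x i)]
    exact hx.norm_error_le hn hp h.symm
  have h3 := hx.norm_error_le hn hp h
  have h4 := mul_le_mul_of_nonneg_right ht3 (norm_nonneg (x i - x j))
  linarith [norm_nonneg (x i - x j)]

end

/-- The error of `T^(m + 1)(x)` and membership in its domain. -/
theorem IsClose.iterFun_succ (hn : 2 ≤ n) (hp : 1 ≤ p) (hpq : p⁻¹ + q⁻¹ = 1) (hf : f ≠ 0)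
    (hξ : f = C f.leadingCoeff * ∏ i, (X - C (ξ i))) (hx : IsClose p q x ξ) (m : ℕ) :
    x ∈ iterDomain f (m + 1) ∧ ∀ i, ‖iterFun f (m + 1) x i - ξ i‖ ≤
      amp n (aConst n q) (relErr p x ξ) *
        ((1 + 2 * relErr p x ξ) * amp n (aConst n q) (relErr p x ξ)) ^ m * ‖x i - ξ i‖ := by
  have ha : 0 ≤ aConst n q := zero_le_one.trans (one_le_aConst hn q)
  have ht := relErr_nonneg (x := x) (ξ := ξ) hp
  have hg := one_add_two_mul_mul_amp_le hn ha ht hx.relErr_le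
  have hA0 := amp_nonneg (n := n) ha ht
  induction m with
  | zero =>
    refine ⟨⟨trivial, fun i j hij => hx.injective.ne hij⟩, fun i => ?_⟩
    have := norm_step_sub_le hn hp hpq hf hξ hx.injective (κ := 1) (l := 1) (y := x) (i := i)
      zero_le_one zero_le_one (by norm_num) (fun j => by rw [one_mul])
      (fun j _ => by rw [one_mul])
    simpa [iterFun] using this
  | succ m ih =>
    obtain ⟨hdom, hb⟩ := ih
    set t := relErr p x ξ
    set β := amp n (aConst n q) t
    have hg0 : 0 ≤ (1 + 2 * t) * β := mul_nonneg (by linarith) hA0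
    have hg1 : (1 + 2 * t) * β ≤ 1 := by linarith
    have hy : ∀ j, ‖iterFun f (m + 1) x j - ξ j‖ ≤ β * ‖x j - ξ j‖ := fun j =>
      (hb j).trans (mul_le_mul_of_nonneg_right
        (mul_le_of_le_one_right hA0 (pow_le_one₀ hg0 hg1)) (norm_nonneg _))
    have hsep := fun i j (h : j ≠ i) => hx.norm_sub_le_mul_norm_sub_step hn hp hy h
    refine ⟨⟨hdom, fun i j hij heq => ?_⟩, fun i => ?_⟩
    · have h1 := hsep i j hij.symm
      rw [heq, sub_self, norm_zero, mul_zero, ← heq] at h1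
      exact hx.injective.ne hij (sub_eq_zero.1 (norm_le_zero_iff.1 h1))
    -- The previous error factor is `κ`; distances to the inner vector cost `l = 1 + 2t`, so each
    -- inner step gains a factor `(1 + 2t) β`.
    · have hκl : β * ((1 + 2 * t) * β) ^ m * (1 + 2 * t) = ((1 + 2 * t) * β) ^ (m + 1) := by ring
      have := norm_step_sub_le hn hp hpq hf hξ hx.injective (y := iterFun f (m + 1) x) (i := i)
        (κ := β * ((1 + 2 * t) * β) ^ m) (l := 1 + 2 * t) (mul_nonneg hA0 (pow_nonneg hg0 m))
        (by linarith) (by rw [hκl]; exact pow_le_one₀ hg0 hg1) hb (hsep i)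
      rw [hκl, mul_comm _ (amp _ _ _)] at this
      exact this

end Local

/-! ### The radius of validity. -/

section Radius

variable {n : ℕ} {a : ℝ}

/-- Equivalently, at `t = radius n a` the quadratic of `α` vanishes at `τ / (a + 2)`. -/
theorem radius_mul_eq (hn : 2 ≤ n) (ha : 1 ≤ a) :
    radius n a * (1 + (a - 1) * (tau n / (a + 2))) =
      tau n / (a + 2) * (1 - tau n / (a + 2)) := by
  have h1 : a + 2 ≠ 0 := by positivity
  have h2 : a + 2 + (a - 1) * tau n ≠ 0 :=
    (add_pos_of_pos_of_nonneg (by linarith) (mul_nonneg (by linarith) (tau_pos hn).le)).ne'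
  rw [mul_comm (a - 1)] at h2
  rw [radius]
  field_simp

theorem le_radius (hn : 2 ≤ n) (ha : 1 ≤ a) :
    tau n * (a + 1) / ((a + 2) * (2 * a + 1)) ≤ radius n a := by
  have h0 := tau_pos hn
  have h2 : 0 ≤ (a - 1) * tau n := mul_nonneg (by linarith) h0.le
  rw [radius, div_le_div_iff₀ (by positivity) (mul_pos (by linarith) (by linarith))]
  -- This is the difference of the two sides after cross-multiplication.
  have : 0 ≤ tau n * (a + 2) * (a * (a + 2) * (1 - tau n)) := by
    have := sub_nonneg.2 (tau_le_one hn)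
    positivity
  linarith

theorem add_one_mul_radius_lt (hn : 2 ≤ n) (ha : 1 ≤ a) : (a + 1) * radius n a < 1 / 2 := by
  have h0 := tau_pos hn
  have h1 := sub_nonneg.2 (tau_le_one hn)
  have h2 : 0 ≤ (a - 1) * tau n := mul_nonneg (by linarith) h0.le
  rw [radius, ← mul_div_assoc, div_lt_div_iff₀ (mul_pos (by linarith) (by linarith)) two_pos]
  have h3 : 0 ≤ (1 - tau n) * ((a + 2) * (a + 3) - 2 * (a + 1) * (1 + tau n)) :=
    mul_nonneg h1 (by nlinarith)
  linarith

end Radius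

/-! ### Invariance, convergence and its order. -/

section Convergence

open Polynomial

variable {K : Type*} [NormedField K] {n : ℕ} {p q : ℝ≥0∞} {f : K[X]} {x ξ : Fin n → K}

/-- A convex function vanishing at `0` lies below its chord. Linearity of the bound in `t` is what
produces the order of convergence. -/
theorem amp_le_div (hn : 2 ≤ n) {a t : ℝ} (ha : 0 ≤ a) (ht : 0 ≤ t)
    (htR : t ≤ tau n / (a + 2)) :
    amp n a t ≤ t / (tau n / (a + 2)) * amp n a (tau n / (a + 2)) := by
  have hR : 0 < tau n / (a + 2) := div_pos (tau_pos hn) (by linarith)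
  have := amp_mul_le (n := n) ha hR.le (div_nonneg ht hR.le) ((div_le_one hR).2 htR)
  rwa [div_mul_cancel₀ _ hR.ne'] at this

theorem amp_lt_one (hn : 2 ≤ n) {a : ℝ} (ha : 0 ≤ a) : amp n a (tau n / (a + 2)) < 1 := by
  have hR : 0 < tau n / (a + 2) := div_pos (tau_pos hn) (by linarith)
  have := one_add_two_mul_mul_amp_le hn ha hR.le le_rfl
  nlinarith

theorem isClose_of_localization (hn : 2 ≤ n) (hp : 1 ≤ p) (hx : Function.Injective x)
    (hE : initialFun p f x ≤ radius n (aConst n q))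
    (h : ∀ i, ‖x i - ξ i‖ ≤
      alpha (aConst n q) (initialFun p f x) * ‖weierstrassCorrection f x i‖) :
    IsClose p q x ξ := by
  have ha := one_le_aConst hn q
  have hE0 : 0 ≤ initialFun p f x := initialFun_nonneg hp
  have hE2 : (aConst n q + 1) * initialFun p f x < 1 / 2 :=
    (mul_le_mul_of_nonneg_left hE (by linarith)).trans_lt (add_one_mul_radius_lt hn ha)
  have hR : 0 < tau n / (aConst n q + 2) := div_pos (tau_pos hn) (by linarith)
  refine ⟨hx, le_trans ?_ (alpha_mul_self_le ha hE0 hE2 ?_)⟩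
  · refine pNorm_le_mul_pNorm hp (alpha_nonneg ha hE0 hE2) fun i => ?_
    have hd := minDist_pos hn hx i
    rw [Real.norm_of_nonneg (by positivity), Real.norm_of_nonneg (by positivity),
      ← mul_div_assoc]
    exact div_le_div_of_nonneg_right (h i) hd.le
  · have h1 := radius_mul_eq hn ha
    have h2 := mul_le_mul_of_nonneg_right hE
      (add_nonneg zero_le_one (mul_nonneg (sub_nonneg.2 ha) hR.le))
    linarith

variable (hn : 2 ≤ n) (hp : 1 ≤ p) (hpq : p⁻¹ + q⁻¹ = 1) (hf : f ≠ 0)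
  (hξ : f = C f.leadingCoeff * ∏ i, (X - C (ξ i))) {N : ℕ} (hN : 1 ≤ N) (hx : IsClose p q x ξ)
include hn hp hpq hf hξ hN hx

theorem IsClose.norm_iterFun_sub_le (i : Fin n) : ‖iterFun f N x i - ξ i‖ ≤
    amp n (aConst n q) (relErr p x ξ) * ‖x i - ξ i‖ := by
  obtain ⟨m, rfl⟩ : ∃ m, N = m + 1 := ⟨N - 1, by omega⟩
  have ha : 0 ≤ aConst n q := zero_le_one.trans (one_le_aConst hn q)
  have ht := relErr_nonneg (x := x) (ξ := ξ) hp
  have hg := one_add_two_mul_mul_amp_le hn ha ht hx.relErr_le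
  have hA0 := amp_nonneg (n := n) ha ht
  exact ((hx.iterFun_succ hn hp hpq hf hξ m).2 i).trans (mul_le_mul_of_nonneg_right
    (mul_le_of_le_one_right hA0 (pow_le_one₀ (mul_nonneg (by linarith) hA0) (by linarith)))
    (norm_nonneg _))

theorem IsClose.iterFun : IsClose p q (iterFun f N x) ξ :=
  hx.of_norm_sub_le hn hp (hx.norm_iterFun_sub_le hn hp hpq hf hξ hN)

theorem IsClose.iter (k : ℕ) : IsClose p q (iter f N x k) ξ := by
  induction k with
  | zero => exact hx
  | succ k ih =>
    rw [WeierstrassType.iter, Function.iterate_succ_apply']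
    exact ih.iterFun hn hp hpq hf hξ hN

theorem IsClose.iterWellDefined : IterWellDefined f N x := fun k => by
  obtain ⟨m, rfl⟩ : ∃ m, N = m + 1 := ⟨N - 1, by omega⟩
  exact ((hx.iter hn hp hpq hf hξ hN k).iterFun_succ hn hp hpq hf hξ m).1

theorem IsClose.norm_iter_sub_le (k : ℕ) (i : Fin n) : ‖WeierstrassType.iter f N x k i - ξ i‖ ≤
    amp n (aConst n q) (tau n / (aConst n q + 2)) ^ k * ‖x i - ξ i‖ := by
  have ha : 0 ≤ aConst n q := zero_le_one.trans (one_le_aConst hn q)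
  have hR : 0 < tau n / (aConst n q + 2) := div_pos (tau_pos hn) (by linarith)
  have hA0 := amp_nonneg (n := n) ha hR.le
  induction k with
  | zero => rw [pow_zero, one_mul]; exact le_rfl
  | succ k ih =>
    have hk := hx.iter hn hp hpq hf hξ hN k
    have h1 := hk.norm_iterFun_sub_le hn hp hpq hf hξ hN i
    have h2 := (amp_le_div hn ha (relErr_nonneg hp) hk.relErr_le).trans
      (mul_le_of_le_one_left hA0 ((div_le_one hR).2 hk.relErr_le))
    rw [WeierstrassType.iter, Function.iterate_succ_apply', pow_succ', mul_assoc]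
    exact h1.trans (mul_le_mul h2 ih (norm_nonneg _) hA0)

theorem IsClose.tendsto_iter :
    Filter.Tendsto (WeierstrassType.iter f N x) Filter.atTop (nhds ξ) := by
  have ha : 0 ≤ aConst n q := zero_le_one.trans (one_le_aConst hn q)
  have hR : 0 < tau n / (aConst n q + 2) := div_pos (tau_pos hn) (by linarith)
  rw [tendsto_pi_nhds]
  intro i
  rw [tendsto_iff_norm_sub_tendsto_zero]
  refine squeeze_zero (fun _ => norm_nonneg _)
    (fun k => hx.norm_iter_sub_le hn hp hpq hf hξ hN k i) ?_
  rw [← zero_mul ‖x i - ξ i‖]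
  exact (tendsto_pow_atTop_nhds_zero_of_lt_one (amp_nonneg ha hR.le)
    (amp_lt_one hn ha)).mul_const _

/-- Here `1 + 2t ≤ 2` and `β ≤ t / R` with `R = τ / (a + 2)`. Closeness gives `d_i(x) ≥ δ / 2`,
hence `t ≤ (2 / δ) ‖x - ξ‖_p`. The constant depends on the separation of the zeros and not on `x`,
so it serves every iterate. -/
theorem IsClose.pNorm_iterFun_sub_le {δ : ℝ} (hδ : 0 < δ)
    (hsep : ∀ i j, j ≠ i → δ ≤ ‖ξ i - ξ j‖) :
    pNorm p (WeierstrassType.iterFun f N x - ξ) ≤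
      (2 / (tau n / (aConst n q + 2)) * (2 / δ)) ^ N * pNorm p (x - ξ) ^ (N + 1) := by
  obtain ⟨m, rfl⟩ : ∃ m, N = m + 1 := ⟨N - 1, by omega⟩
  have ha : 0 ≤ aConst n q := zero_le_one.trans (one_le_aConst hn q)
  have hR : 0 < tau n / (aConst n q + 2) := div_pos (tau_pos hn) (by linarith)
  have ht := relErr_nonneg (x := x) (ξ := ξ) hp
  have hA0 := amp_nonneg (n := n) ha ht
  have ht3 := hx.relErr_le.trans (tau_div_le hn (one_le_aConst hn q))
  have hβ : amp n (aConst n q) (relErr p x ξ) ≤ relErr p x ξ / (tau n / (aConst n q + 2)) :=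
    (amp_le_div hn ha ht hx.relErr_le).trans (mul_le_of_le_one_right (div_nonneg ht hR.le)
      (amp_lt_one hn ha).le)
  have hrel : relErr p x ξ ≤ 2 / δ * pNorm p (x - ξ) :=
    pNorm_le_mul_pNorm hp (by positivity) fun i => by
      have hd := minDist_pos hn hx.injective i
      have h1 : δ / 2 ≤ minDist x i := le_minDist hn x fun j hj => by
        linarith [hsep i j hj, hx.norm_root_sub_root_le hn hp hj]
      rw [Real.norm_of_nonneg (by positivity), Pi.sub_apply, mul_comm, div_eq_mul_inv,
        ← inv_div δ 2]
      gcongr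
  have hbd := (hx.iterFun_succ hn hp hpq hf hξ m).2
  set R := tau n / (aConst n q + 2)
  set t := relErr p x ξ
  set β := amp n (aConst n q) t
  have hc : β * ((1 + 2 * t) * β) ^ m ≤ (2 / R * (2 / δ) * pNorm p (x - ξ)) ^ (m + 1) := by
    have h1 : t / R ≤ 1 / R * (2 / δ * pNorm p (x - ξ)) := by
      rw [div_eq_mul_inv, mul_comm, one_div]
      gcongr
    have hE := pNorm_nonneg hp (x - ξ)
    have h2 : 2 * β ≤ 2 / R * (2 / δ) * pNorm p (x - ξ) := by
      have e : 2 / R * (2 / δ) * pNorm p (x - ξ) = 2 * (1 / R * (2 / δ * pNorm p (x - ξ))) := by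
        ring
      rw [e]
      linarith
    rw [pow_succ']
    refine mul_le_mul (by linarith) (pow_le_pow_left₀ (mul_nonneg (by linarith) hA0) ?_ m)
      (pow_nonneg (mul_nonneg (by linarith) hA0) m) (by positivity)
    exact (mul_le_mul_of_nonneg_right (by linarith) hA0).trans h2
  calc _ ≤ β * ((1 + 2 * t) * β) ^ m * pNorm p (x - ξ) :=
        pNorm_le_mul_pNorm hp
          (mul_nonneg hA0 (pow_nonneg (mul_nonneg (by linarith) hA0) m)) hbd
    _ ≤ (2 / R * (2 / δ) * pNorm p (x - ξ)) ^ (m + 1) * pNorm p (x - ξ) :=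
        mul_le_mul_of_nonneg_right hc (pNorm_nonneg hp _)
    _ = _ := by rw [mul_pow, mul_assoc, ← pow_succ]

theorem IsClose.convergesWithOrder (hinj : Function.Injective ξ) :
    ConvergesWithOrder p (N + 1) (WeierstrassType.iter f N x) ξ := by
  have : Nonempty (Fin n) := ⟨⟨0, by omega⟩⟩
  obtain ⟨i₀, hi₀⟩ := Finite.exists_min (minDist ξ)
  refine ⟨hx.tendsto_iter hn hp hpq hf hξ hN,
    (2 / (tau n / (aConst n q + 2)) * (2 / minDist ξ i₀)) ^ N, fun k => ?_⟩
  rw [WeierstrassType.iter, Function.iterate_succ_apply']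
  exact (hx.iter hn hp hpq hf hξ hN k).pNorm_iterFun_sub_le hn hp hpq hf hξ hN
    (minDist_pos hn hinj i₀) fun i j hj => (hi₀ i).trans (minDist_le ξ hj)

end Convergence

end WeierstrassType

theorem mainTheorem7 {K : Type*} [NormedField K] [IsAlgClosed K]
    (n : ℕ) (hn : 2 ≤ n) (f : Polynomial K) (hf : f.natDegree = n)
    (N : ℕ) (hN : 1 ≤ N)
    (p q : ℝ≥0∞) (hp : 1 ≤ p) (hpq : p⁻¹ + q⁻¹ = 1)
    (a : ℝ) (ha : a = WeierstrassType.aConst n q)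
    (x₀ : Fin n → K) (hx₀ : Function.Injective x₀)
    (hE : WeierstrassType.initialFun p f x₀ ≤
      WeierstrassType.tau n * (a + 1) / ((a + 2) * (2 * a + 1))) :
    WeierstrassType.HasOnlySimpleZeros f ∧
    WeierstrassType.IterWellDefined f N x₀ ∧
    ∃ ξ : Fin n → K,
      WeierstrassType.IsRootVector f ξ ∧
      WeierstrassType.ConvergesWithOrder p (N + 1) (WeierstrassType.iter f N x₀) ξ ∧
      ∀ k : ℕ,
        WeierstrassType.initialFun p f (WeierstrassType.iter f N x₀ k) ≤
            WeierstrassType.radius n a →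
          ∀ i : Fin n,
            ‖WeierstrassType.iter f N x₀ k i - ξ i‖ ≤
              WeierstrassType.alpha a
                  (WeierstrassType.initialFun p f (WeierstrassType.iter f N x₀ k)) *
                ‖WeierstrassType.weierstrassCorrection f
                    (WeierstrassType.iter f N x₀ k) i‖ := by
  open WeierstrassType in
  subst ha
  have ha := one_le_aConst hn q
  have hf0 : f ≠ 0 := by rintro rfl; simp at hf; omega
  have hE1 := hE.trans (le_radius hn ha)
  have hsmall : ∀ t, t ≤ radius n (aConst n q) → (aConst n q + 1) * t < 1 / 2 := fun t ht =>
    (mul_le_mul_of_nonneg_left ht (by linarith)).trans_lt (add_one_mul_radius_lt hn ha)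
  obtain ⟨ξ, hinj, hprod, hloc⟩ := exists_rootVector hn hp hpq hf hx₀ (hsmall _ hE1)
  have hx : IsClose p q x₀ ξ := isClose_of_localization hn hp hx₀ hE1 hloc
  refine ⟨hasOnlySimpleZeros_of_eq_prod hinj hprod hf0, hx.iterWellDefined hn hp hpq hf0 hprod hN,
    ξ, ⟨f.leadingCoeff, fun z => ?_⟩, hx.convergesWithOrder hn hp hpq hf0 hprod hN hinj,
    fun k hk i => ?_⟩
  · conv_lhs => rw [hprod]
    simp [Polynomial.eval_prod]
  -- No new matching of zeros is needed: invariance keeps the relative error at most `1/3`, so `ξ i`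
  -- satisfies the proximity condition of `norm_sub_root_le` at every iterate.
  · have hxk := hx.iter hn hp hpq hf0 hprod hN k
    refine norm_sub_root_le hn hp hpq hf0 hf hxk.injective (hsmall _ hk) ?_ ?_
    · rw [hprod, ← Polynomial.dvd_iff_isRoot]
      exact (Finset.dvd_prod_of_mem (fun i => Polynomial.X - Polynomial.C (ξ i))
        (Finset.mem_univ i)).mul_left _
    · have h1 := norm_sub_le_relErr_mul (ξ := ξ) hn hp hxk.injective i
      have h2 := mul_le_mul_of_nonneg_right (hxk.relErr_le.trans (tau_div_le hn ha))
        (minDist_pos hn hxk.injective i).le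
      linarith [minDist_pos hn hxk.injective i]
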